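/- Conventions. A representation of a set $M$ is a partial surjection $\delta:\subseteq\mathbb N^{\mathbb N}\to M$; $p$ is a $\delta$-name of $x$ if $\delta(p)=x$. A multi-valued operation $f:\subseteq M\rightrightarrows N$ is $(\delta;\delta')$-computable if there is a (Type-2) computable $F:\subseteq\mathbb N^{\mathbb N}\to\mathbb N^{\mathbb N}$ such that, for every $x\in\operatorname{dom}f$ and every $\delta$-name $p$ of $x$, $F(p)$ is defined and is a $\delta'$-name of some element of $f(x)$; such an $F$ (computable or not) is a realizer of $f$. We write $\delta\le\delta'$ if a computable function translates every $\delta$-name into a $\delta'$-name of the same object. $[\delta,\delta']$ is the product representation, $\delta^{\omega}$ the representation of sequences, and a $\delta\sqcap\delta'$-name of $x$ is a pair of a $\delta$-name and a $\delta'$-name of $x$. $\eta$ is the canonical representation of the continuous partial functions $\subseteq\mathbb N^{\mathbb N}\to\mathbb N^{\mathbb N}$ with $\Pi^0_2$ domain. Let $(X,d,\nu)$ be a computable metric space: $(X,d)$ is a metric space, $\nu:\mathbb N\to X$ is a sequence with dense range, and $(i,j)\mapsto d(\nu(i),\nu(j))$ is a computable double sequence of reals. A $\delta_X$-name of $x\in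 X$ is $p$ with $d(\nu(p_i),\nu(p_j))<2^{-\min\{i,j\}}$ for all $i,j$ and $\nu(p_i)\to x$. A $\delta_{\Sigma^0_1(X)}$-name of an open set $U$ is $p$ such that $U$ is the union of the rational balls about points of $\nu$ that are coded by the numbers $p_i-1$ with $p_i\ge 1$. A $\delta_{\Pi^0_1(X)}$-name of a closed set $A$ is a $\delta_{\Sigma^0_1(X)}$-name of $X\setminus A$. A $\delta_{\mathrm{range}}$-name of a nonempty closed set $A$ lists $\delta_X$-names (with entries shifted by one) of the members of a sequence dense in $A$; the only name of $\emptyset$ is $000\dots$. A $\delta^{>}_{\mathrm{dist}}$-name of a closed set $A$ is $p$ such that $\eta_p$ computes, from each $\delta_X$-name of each $x\in X$, an enumeration of the rationals below $d_A(x)=\inf_{a\in A}d(x,a)\in[0,\infty]$. A $[\delta_X\to\delta_X]_{\Pi^0_1(X)}$-name of a partial continuous map $f:\subseteq X\to X$ with closed domain is a pair $\langle p,q\rangle$ such that $\eta_p$ is a $(\delta_X,\delta_X)$-realizer of $f$ and $q$ is a $\delta_{\Pi^0_1(X)}$-name of $\operatorname{dom}f$. Theorem. Let $\mathcal Y$ be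 a class of closed subsets $A$ of $X$ with $\dim A\le 0$, and let $\delta_{\mathcal Y}$ be a representation of $\mathcal Y$ with $\delta_{\mathcal Y}\le\delta_{\Pi^0_1(X)}$. Assume that the operation $\tilde S$, which maps each sequence $(V_i)_{i\in\mathbb N}$ of open subsets of $X$ and each $Y\in\mathcal Y$ to $$\tilde S((V_i)_i,Y)=\Big\{(W_i)_i \;:\; W_i\subseteq V_i \text{ open},\ \bigcup_i W_i\cap Y=\bigcup_i V_i\cap Y,\ W_i\cap W_j=\emptyset\text{ for all } i\ne j\Big\},$$ is $([\delta_{\Sigma^0_1(X)}^{\omega},\delta_{\mathcal Y}];\delta_{\Sigma^0_1(X)}^{\omega})$-computable. Then the operation $E'$ with domain $$\operatorname{dom}E'=\{(A,B)\;:\;A\in\mathcal Y,\ B\subseteq X\text{ closed},\ \emptyset\ne B\subseteq A,\ B\ne X\}$$ and $$E'(A,B)=\{f:\subseteq X\to X \text{ continuous}\;:\;\operatorname{dom}f=A,\ f(A)=B,\ f|_B=\mathrm{id}_B\}$$ is $([\delta_{\mathcal Y},\delta_{\mathrm{range}}\sqcap\delta^{>}_{\mathrm{dist}}];[\delta_X\to\delta_X]_{\Pi^0_1(X)})$-computable.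 -/

import Mathlib

open Set TopologicalSpace

namespace TTE

/-! ### Computability on Baire space -/

/-- Baire space `ℕ^ℕ`, the space of names. -/
abbrev Baire := ℕ → ℕ

/-- The binary pairing `⟨p, q⟩ = p₀ q₀ p₁ q₁ …` is inverted by `left` and `right`. -/
def left (r : Baire) : Baire := fun n => r (2 * n)

/-- Second component of a name `r = ⟨p, q⟩ = p₀ q₀ p₁ q₁ …`. -/
def right (r : Baire) : Baire := fun n => r (2 * n + 1)

/-- The `j`-th component `p⁽ʲ⁾` of `r = ⟨p⁽⁰⁾, p⁽¹⁾, …⟩`, where `r ⟨j, k⟩ = p⁽ʲ⁾ k`. -/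
def component (r : Baire) (j : ℕ) : Baire := fun k => r (Nat.pair j k)

/-- The answer that the associate `p` gives to the question "what is the `n`-th digit of the
output?" when it has read the first `m` digits of the input `q`:
`0` means "undecided, read on", `v + 1` means "the digit is `v`". -/
def answer (p q : Baire) (n m : ℕ) : ℕ :=
  p (Nat.pair n (Encodable.encode ((List.range m).map q)))

open Classical in
/-- The canonical total representation `p ↦ η_p` of the continuous partial functions
`⊆ ℕ^ℕ → ℕ^ℕ` with `Π⁰₂` domain (`p` is an associate of `η_p` in the sense of Kleene):
the `n`-th digit of `η_p q` is the first decided answer, and `q` is in the domain iff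
every digit is eventually decided. -/
noncomputable def eta (p : Baire) : Baire →. Baire := fun q =>
  ⟨∀ n, ∃ m, answer p q n m ≠ 0, fun h n => answer p q n (Nat.find (h n)) - 1⟩

/-! ### Representations and realizers -/

/-- A naming system for (some of) the elements of `M`: `δ p x` says that `p` is a `δ`-name
of `x`, i.e. `p ∈ δ⁻¹{x}`. -/
abbrev Naming (M : Type*) := Baire → M → Prop

/-- `δ` is a representation of the set `S`: a partial surjection `⊆ ℕ^ℕ → S`. -/
structure IsRepresentation {M : Type*} (δ : Naming M) (S : Set M) : Prop where
  unique : ∀ p x y, δ p x → δ p y → x = y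
  mem : ∀ p x, δ p x → x ∈ S
  surj : ∀ x ∈ S, ∃ p, δ p x

/-- `F` is a `(δ, δ')`-realizer of the multi-valued operation `f : ⊆ M ⇉ N` with domain `D`. -/
def Realizes {M N : Type*} (F : Baire →. Baire) (δ : Naming M) (δ' : Naming N)
    (D : Set M) (f : M → Set N) : Prop :=
  ∀ x ∈ D, ∀ p, δ p x → ∃ r ∈ F p, ∃ y ∈ f x, δ' r y

/-- The multi-valued operation `f : ⊆ M ⇉ N` with domain `D` is `(δ; δ')`-computable: it has a
computable realizer, i.e. a realizer `η_e` with `e : ℕ → ℕ` computable. -/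
def ComputableOp {M N : Type*} (δ : Naming M) (δ' : Naming N)
    (D : Set M) (f : M → Set N) : Prop :=
  ∃ e : Baire, Computable e ∧ Realizes (eta e) δ δ' D f

/-- Reducibility `δ ≤ δ'`: a computable function translates `δ`-names into `δ'`-names. -/
def Reduces {M : Type*} (δ δ' : Naming M) : Prop :=
  ∃ e : Baire, Computable e ∧ ∀ p x, δ p x → ∃ r ∈ eta e p, δ' r x

/-- The product representation `[δ, δ']`. -/
def prodRep {M N : Type*} (δ : Naming M) (δ' : Naming N) : Naming (M × N) :=
  fun r z => δ (left r) z.1 ∧ δ' (right r) z.2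

/-- The sequence representation `δ^ω`. -/
def seqRep {M : Type*} (δ : Naming M) : Naming (ℕ → M) :=
  fun r x => ∀ j, δ (component r j) (x j)

/-- The meet `δ ⊓ δ'`: a name of `x` consists of a `δ`-name and a `δ'`-name of `x`. -/
def meetRep {M : Type*} (δ δ' : Naming M) : Naming M :=
  fun r x => δ (left r) x ∧ δ' (right r) x

/-! ### Numberings of rationals, and computable metric spaces -/

/-- A standard total numbering of `ℚ`: `⟨⟨a, b⟩, c⟩ ↦ (a - b) / (c + 1)`. -/
def nuQ (n : ℕ) : ℚ :=
  (((n.unpair.1.unpair.1 : ℕ) : ℚ) - ((n.unpair.1.unpair.2 : ℕ) : ℚ)) /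
    (((n.unpair.2 : ℕ) : ℚ) + 1)

/-- A standard total numbering of the positive rationals: `⟨a, b⟩ ↦ (a + 1) / (b + 1)`. -/
def nuQpos (n : ℕ) : ℚ := (((n.unpair.1 : ℕ) : ℚ) + 1) / (((n.unpair.2 : ℕ) : ℚ) + 1)

/-- `(X, d, ν)` is a computable metric space: `ν` is a dense sequence, and `d (ν i) (ν j)` is a
computable real uniformly in `i, j`. -/
structure IsComputableMetricSpace {X : Type*} [MetricSpace X] (ν : ℕ → X) : Prop where
  dense : DenseRange ν
  dist_computable : ∃ f : ℕ × ℕ × ℕ → ℕ, Computable f ∧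
    ∀ i j n, |dist (ν i) (ν j) - ((nuQ (f (i, j, n)) : ℚ) : ℝ)| < (2 : ℝ)⁻¹ ^ n

section Hyperspaces

variable {X : Type*} [MetricSpace X] (ν : ℕ → X)

/-- The Cauchy representation `δ_X` of `X`. -/
def cauchyRep : Naming X := fun p x =>
  (∀ i j, dist (ν (p i)) (ν (p j)) < (2 : ℝ)⁻¹ ^ min i j) ∧
    Filter.Tendsto (fun i => ν (p i)) Filter.atTop (nhds x)

/-- The numbering of ideal open balls, `⟨a, r⟩ ↦ B(ν a; ν_{ℚ⁺} r)`. -/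
def idealBall (n : ℕ) : Set X := Metric.ball (ν n.unpair.1) ((nuQpos n.unpair.2 : ℚ) : ℝ)

/-- The representation `δ_{Σ⁰₁(X)}` of open sets: `p` lists (codes, shifted by one, of) ideal balls
with union `U`; the entry `0` means "no information". -/
def sigmaRep : Naming (Opens X) := fun p U =>
  (U : Set X) = ⋃ i ∈ {i : ℕ | 1 ≤ p i}, idealBall ν (p i - 1)

/-- The representation `δ_{Π⁰₁(X)}` of closed sets: names of the complement. -/
def piRep : Naming (Closeds X) := fun p A => sigmaRep ν p A.compl

/-- The representation `δ_range` of closed sets: for `A ≠ ∅` a name is `⟨p⁽⁰⁾, p⁽¹⁾, …⟩`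
where the `p⁽ⁱ⁾`, with all entries shifted by one, name the members of a dense sequence in `A`;
the only name of `∅` is `0^ω`. -/
def rangeRep : Naming (Closeds X) := fun r A =>
  ((A : Set X) = ∅ ∧ ∀ i k, component r i k = 0) ∨
  ((A : Set X).Nonempty ∧ (∀ i k, 1 ≤ component r i k) ∧
    ∃ z : ℕ → X, (∀ i, cauchyRep ν (fun k => component r i k - 1) (z i)) ∧
      (∀ i, z i ∈ A) ∧ (A : Set X) ⊆ closure (range z))

/-- The representation of extended reals by enumerating the rationals strictly below. -/
def lowerRep : Naming EReal := fun p t =>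
  {n : ℕ | (((nuQ n : ℚ) : ℝ) : EReal) < t} = {n : ℕ | ∃ i, 1 ≤ p i ∧ n = p i - 1}

/-- The distance function `d_A : X → [-∞, ∞]` of a closed set; `d_∅ = ∞`. -/
noncomputable def distTo (A : Closeds X) (x : X) : EReal :=
  ((Metric.infEDist x (A : Set X) : ENNReal) : EReal)

/-- The representation `δ_dist^>` of closed sets: `p` is a name of `A` iff `η_p` realizes
`d_A` with respect to the Cauchy representation and the lower representation. -/
def distRep : Naming (Closeds X) := fun p A =>
  Realizes (eta p) (cauchyRep ν) lowerRep univ (fun x => {distTo A x})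

/-- The partial continuous maps `f : ⊆ X → X` with closed domain. -/
def contPi (X : Type*) [TopologicalSpace X] : Set (X →. X) :=
  {f | IsClosed f.Dom ∧ Continuous f.asSubtype}

/-- The representation `[δ_X → δ_X]_{Π⁰₁(X)}`: a name `⟨p, q⟩` of `f` consists of `p` such that
`η_p` realizes `f`, and a `δ_{Π⁰₁(X)}`-name `q` of the domain of `f`. -/
def contPiRep : Naming (X →. X) := fun r f =>
  f ∈ contPi X ∧
  Realizes (eta (left r)) (cauchyRep ν) (cauchyRep ν) f.Dom (fun x => {y | y ∈ f x}) ∧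
  ∃ C : Closeds X, piRep ν (right r) C ∧ f.Dom = (C : Set X)

/-! ### The two operations -/

/-- The disjointification operation `S̃`. -/
def disjointify (z : (ℕ → Opens X) × Closeds X) : Set (ℕ → Opens X) :=
  {W | (∀ i, W i ≤ z.1 i) ∧
    (⋃ i, (W i : Set X)) ∩ z.2 = (⋃ i, (z.1 i : Set X)) ∩ z.2 ∧
    ∀ i j, i ≠ j → (W i : Set X) ∩ W j = ∅}

/-- `S̃ : Σ⁰₁(X)^ℕ × 𝒴 ⇉ Σ⁰₁(X)^ℕ` is computable. -/
def DisjointifyComputable (𝒴 : Set (Closeds X)) (δY : Naming (Closeds X)) : Prop :=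
  ComputableOp (prodRep (seqRep (sigmaRep ν)) δY) (seqRep (sigmaRep ν))
    {z | z.2 ∈ 𝒴} disjointify

/-- The domain of `E'`: pairs `(A, B)` with `A ∈ 𝒴`, `∅ ≠ B ⊆ A` and `B ≠ X`. -/
def retractDom (𝒴 : Set (Closeds X)) : Set (Closeds X × Closeds X) :=
  {z | z.1 ∈ 𝒴 ∧ (z.2 : Set X).Nonempty ∧ (z.2 : Set X) ⊆ z.1 ∧ (z.2 : Set X) ≠ univ}

/-- The retraction operation `E'`: the value at `(A, B)` is the set of all retractions of `A`
onto `B`, as partial continuous maps with domain `A`. -/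
def retract (z : Closeds X × Closeds X) : Set (X →. X) :=
  {f | f ∈ contPi X ∧ f.ran = (z.2 : Set X) ∧ (∀ b ∈ z.2, b ∈ f b) ∧ f.Dom = (z.1 : Set X)}

/-- `E'` is computable, where `A` is given by `δY`, and `B` by `δ_range ⊓ δ_dist^>`. -/
def RetractComputable (𝒴 : Set (Closeds X)) (δY : Naming (Closeds X)) : Prop :=
  ComputableOp (prodRep δY (meetRep (rangeRep ν) (distRep ν))) (contPiRep ν)
    (retractDom 𝒴) retract

end Hyperspaces

end TTE

/-! The retraction is built by sending points outside `B` to nearly closest points of `B`. Let `z`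
be the dense sequence of `B` supplied by its range name. Call a ball with centre `a`, radius `ρ` and
an attached index `k` admissible if `2ρ < d_B(a)` and `d(a, z k) < 4ρ`. The lower distance name of
`B` verifies the first inequality and the range name verifies the second, so the admissible triples
can be enumerated. Their balls cover exactly the complement of `B`, and each point `x` of such a
ball satisfies `d(x, z k) ≤ 5 d_B(x)`.

Applied to this cover and `A`, the operation `S̃` yields disjoint open sets that are contained in
the balls and cover `A \ B` within `A`. Let `F` be the constant `z k` on each piece within `A`, and
the identity on `B`. Off `B` it is locally constant. At `b ∈ B` it is continuous because `d(F x, b)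
≤ 6 d(x, b)` (`exists_retraction`).

It is not decidable whether `x ∈ B`, so the `n`-th digit of `F x` comes from a race between two
semidecidable events. If `x` is seen in a piece, a digit from the name of the attached `z k` is
used. If `x` is seen to be very close to `B`, then `F x` is close to `x`, and a digit of the name of
`x` itself is used. One event always occurs (`exists_digit`), and either gives a sufficiently exact
digit (`dist_digit_le`).

The computability bookkeeping uses relations semidecidable in an oracle (`Semi`). A total relation
of this kind has a computable choice function (`Semi.exists_realizer`), or, with a second oracle, an
associate computable from the first (`Semi.exists_associate`). -/

namespace TTE

/-! ### Relations that are semidecidable relative to an oracle -/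

section Semi

variable {α β γ : Type*} [Primcodable α] [Primcodable β] [Primcodable γ]

/-- The list of the first `m` values of the oracle `o`. -/
def pre {γ : Type*} (o : ℕ → γ) (m : ℕ) : List γ := (List.range m).map o

@[simp] lemma length_pre {γ : Type*} (o : ℕ → γ) (m : ℕ) : (pre o m).length = m := by simp [pre]

lemma take_pre {γ : Type*} (o : ℕ → γ) {i m : ℕ} (h : i ≤ m) : (pre o m).take i = pre o i := by
  simp [pre, ← List.map_take, List.take_range, h]

/-- `R` is semidecidable relative to the oracle: whether `R o a` holds can be recognized, uniformly
in `a`, from a finite initial segment of `o`. -/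
def Semi (R : (ℕ → γ) → α → Prop) : Prop :=
  ∃ g : List γ × α → Bool, Computable g ∧ ∀ o a, R o a ↔ ∃ m, g (pre o m, a) = true

lemma computable_all_lt {f : α × ℕ → Bool} (hf : Computable f) :
    ∃ g : α × ℕ → Bool, Computable g ∧ ∀ a n, g (a, n) = true ↔ ∀ i < n, f (a, i) = true := by
  refine ⟨fun x => Nat.rec (motive := fun _ => Bool) true
    (fun i b => cond b (f (x.1, i)) false) x.2, ?_, ?_⟩
  · refine Computable.nat_rec (h := fun x y => cond y.2 (f (x.1, y.1)) false) Computable.snd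
      (Computable.const true) ?_
    refine Computable.cond (Computable.snd.comp Computable.snd)
      (hf.comp (Computable.pair (Computable.fst.comp Computable.fst)
        (Computable.fst.comp Computable.snd))) (Computable.const false)
  · intro a n
    induction n with
    | zero => simp
    | succ n ih =>
      rw [Nat.forall_lt_succ_right, ← ih]
      simp

lemma computable_any_lt {f : α × ℕ → Bool} (hf : Computable f) :
    ∃ g : α × ℕ → Bool, Computable g ∧ ∀ a n, g (a, n) = true ↔ ∃ i < n, f (a, i) = true := by
  obtain ⟨g, hg, h⟩ := computable_all_lt (f := fun x => !(f x)) (Primrec.not.to_comp.comp hf)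
  refine ⟨fun x => !(g x), Primrec.not.to_comp.comp hg, fun a n => ?_⟩
  have := h a n
  rw [← not_iff_not] at this
  simpa using this

/-- Testing all prefixes of the given list makes acceptance persist, so that several searches can
later share one prefix. -/
lemma Semi.exists_monotone {R : (ℕ → γ) → α → Prop} (h : Semi R) :
    ∃ g : List γ × α → Bool, Computable g ∧ (∀ o a, R o a ↔ ∃ m, g (pre o m, a) = true) ∧
      ∀ o a m m', m ≤ m' → g (pre o m, a) = true → g (pre o m', a) = true := by
  obtain ⟨g, hg, h⟩ := h
  obtain ⟨G, hG, H⟩ := computable_any_lt (α := List γ × α)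
    (f := fun x => g (x.1.1.take x.2, x.1.2))
    (hg.comp (Computable.pair (Primrec.list_take.to_comp.comp Computable.snd
      (Computable.fst.comp Computable.fst)) (Computable.snd.comp Computable.fst)))
  have key : ∀ o a m, G ((pre o m, a), m + 1) = true ↔ ∃ i ≤ m, g (pre o i, a) = true := by
    intro o a m
    rw [H]
    constructor
    · rintro ⟨i, hi, h⟩
      exact ⟨i, by omega, by rwa [take_pre o (by omega)] at h⟩
    · rintro ⟨i, hi, h⟩
      exact ⟨i, by omega, by rwa [take_pre o (by omega)]⟩
  refine ⟨fun x => G (x, x.1.length + 1), hG.comp (Computable.pair Computable.id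
    (Computable.succ.comp (Computable.list_length.comp Computable.fst))), fun o a => ?_, ?_⟩
  · simp only [length_pre, key]
    rw [h]
    exact ⟨fun ⟨m, hm⟩ => ⟨m, m, le_rfl, hm⟩, fun ⟨_, i, _, hi⟩ => ⟨i, hi⟩⟩
  · intro o a m m' hm
    simp only [length_pre, key]
    exact fun ⟨i, hi, h⟩ => ⟨i, hi.trans hm, h⟩

lemma Semi.of_iff {R S : (ℕ → γ) → α → Prop} (h : Semi R) (H : ∀ o a, S o a ↔ R o a) :
    Semi S := by
  obtain ⟨g, hg, h⟩ := h
  exact ⟨g, hg, fun o a => (H o a).trans (h o a)⟩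

lemma Semi.of_computable {g : α → Bool} (hg : Computable g) :
    Semi fun (_ : ℕ → γ) a => g a = true :=
  ⟨fun x => g x.2, hg.comp Computable.snd, fun _ _ => by simp⟩

lemma Semi.of_primrecPred {p : α → Prop} (hp : PrimrecPred p) : Semi fun (_ : ℕ → γ) a => p a := by
  classical
  obtain ⟨_, h⟩ := hp
  exact (Semi.of_computable h.to_comp).of_iff fun _ a => by simp

lemma Semi.comp {R : (ℕ → γ) → β → Prop} (h : Semi R) {f : α → β} (hf : Computable f) :
    Semi fun o a => R o (f a) := by
  obtain ⟨g, hg, h⟩ := h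
  exact ⟨fun x => g (x.1, f x.2), hg.comp (Computable.pair Computable.fst
    (hf.comp Computable.snd)), fun o a => h o (f a)⟩

lemma Semi.eq {f g : α → ℕ} (hf : Computable f) (hg : Computable g) :
    Semi fun (_ : ℕ → γ) a => f a = g a :=
  (Semi.of_primrecPred (p := fun x : ℕ × ℕ => x.1 = x.2) Primrec.eq).comp
    (f := fun a => (f a, g a)) (hf.pair hg)

lemma Semi.lt {f g : α → ℕ} (hf : Computable f) (hg : Computable g) :
    Semi fun (_ : ℕ → γ) a => f a < g a :=
  (Semi.of_primrecPred (p := fun x : ℕ × ℕ => x.1 < x.2) Primrec.nat_lt).comp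
    (f := fun a => (f a, g a)) (hf.pair hg)

lemma Semi.and {R S : (ℕ → γ) → α → Prop} (hR : Semi R) (hS : Semi S) :
    Semi fun o a => R o a ∧ S o a := by
  obtain ⟨g, hg, h, hm⟩ := hR.exists_monotone
  obtain ⟨g', hg', h', hm'⟩ := hS.exists_monotone
  refine ⟨fun x => g x && g' x, Primrec.and.to_comp.comp hg hg', fun o a => ?_⟩
  simp only [h, h']
  constructor
  · rintro ⟨⟨m, h1⟩, ⟨m', h2⟩⟩
    exact ⟨max m m', by simp [hm _ _ _ _ (le_max_left m m') h1,
      hm' _ _ _ _ (le_max_right m m') h2]⟩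
  · rintro ⟨m, h⟩
    simp only [Bool.and_eq_true] at h
    exact ⟨⟨m, h.1⟩, ⟨m, h.2⟩⟩

lemma Semi.or {R S : (ℕ → γ) → α → Prop} (hR : Semi R) (hS : Semi S) :
    Semi fun o a => R o a ∨ S o a := by
  obtain ⟨g, hg, h⟩ := hR
  obtain ⟨g', hg', h'⟩ := hS
  refine ⟨fun x => g x || g' x, Primrec.or.to_comp.comp hg hg', fun o a => ?_⟩
  simp only [h, h', Bool.or_eq_true, exists_or]

/-- Dovetailing: the length of the prefix codes a pair of a candidate witness and a stage, and it is
at least as large as that stage, so monotonicity applies. -/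
lemma Semi.exists {R : (ℕ → γ) → α × β → Prop} (h : Semi R) :
    Semi fun o a => ∃ b, R o (a, b) := by
  obtain ⟨g, hg, h, hm⟩ := h.exists_monotone
  refine ⟨fun x => ((Encodable.decode (α := β) x.1.length.unpair.1).map
      fun b => g (x.1, (x.2, b))).getD false, ?_, fun o a => ?_⟩
  · refine Computable.option_getD (Computable.option_map (Computable.decode.comp
      (Computable.fst.comp (Computable.unpair.comp
        (Computable.list_length.comp Computable.fst)))) ?_) (Computable.const false)
    exact hg.comp (Computable.pair (Computable.fst.comp Computable.fst)
      (Computable.pair (Computable.snd.comp Computable.fst) Computable.snd))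
  · constructor
    · rintro ⟨b, hb⟩
      obtain ⟨m, hb⟩ := (h _ _).1 hb
      refine ⟨Nat.pair (Encodable.encode b) m, ?_⟩
      simp [hm _ _ _ _ (Nat.right_le_pair (Encodable.encode b) m) hb]
    · rintro ⟨m, hb⟩
      cases hd : (Encodable.decode (α := β) m.unpair.1) with
      | none => simp [hd] at hb
      | some b =>
        simp only [length_pre, hd, Option.map_some, Option.getD_some] at hb
        exact ⟨b, (h _ _).2 ⟨m, hb⟩⟩

lemma Semi.forall_lt {R : (ℕ → γ) → α × ℕ → Prop} (h : Semi R) {n : α → ℕ} (hn : Computable n) :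
    Semi fun o a => ∀ i < n a, R o (a, i) := by
  obtain ⟨g, hg, h, hm⟩ := h.exists_monotone
  obtain ⟨G, hG, H⟩ := computable_all_lt (α := List γ × α)
    (f := fun x => g (x.1.1, (x.1.2, x.2))) (hg.comp (Computable.pair
      (Computable.fst.comp Computable.fst) (Computable.pair (Computable.snd.comp Computable.fst)
        Computable.snd)))
  refine ⟨fun x => G (x, n x.2), hG.comp (Computable.pair Computable.id
    (hn.comp Computable.snd)), fun o a => ?_⟩
  simp only [H, h]
  constructor
  · intro h
    choose! m hm' using h
    refine ⟨(Finset.range (n a)).sup m, fun i hi => hm _ _ _ _ ?_ (hm' i hi)⟩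
    exact Finset.le_sup (f := m) (Finset.mem_range.2 hi)
  · exact fun ⟨m, h⟩ i hi => ⟨m, h i hi⟩

/-- A value that depends on a prefix of known length is recognized by accepting only at exactly that
length. -/
lemma Semi.graph [DecidableEq β] {s : α → ℕ} (hs : Computable s) {h : List γ × α → β}
    (hh : Computable h) :
    Semi fun o (x : α × β) => h (pre o (s x.1), x.1) = x.2 := by
  refine ⟨fun x => decide (s x.2.1 = x.1.length) && decide (h (x.1, x.2.1) = x.2.2), ?_, ?_⟩
  · refine Primrec.and.to_comp.comp ((PrimrecPred.decide Primrec.eq).to_comp.comp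
      (Computable.pair (hs.comp (Computable.fst.comp Computable.snd))
        (Computable.list_length.comp Computable.fst))) ((PrimrecPred.decide Primrec.eq).to_comp.comp
      (Computable.pair (hh.comp (Computable.pair Computable.fst (Computable.fst.comp
        Computable.snd))) (Computable.snd.comp Computable.snd)))
  · intro o a
    simp only [length_pre, Bool.and_eq_true, decide_eq_true_eq]
    exact ⟨fun h => ⟨_, rfl, h⟩, fun ⟨m, h1, h2⟩ => by rwa [h1]⟩

lemma Semi.lookup [DecidableEq γ] {k : α → ℕ} (hk : Computable k) {v : α → γ} (hv : Computable v) :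
    Semi fun (o : ℕ → γ) a => o (k a) = v a := by
  refine ((Semi.graph (γ := γ) (s := fun n : ℕ => n + 1) Computable.succ
    (h := fun x => x.1[x.2]?) (Computable.list_getElem?.comp Computable.fst Computable.snd)).comp
    (f := fun a => (k a, some (v a))) (hk.pair (Computable.option_some.comp hv))).of_iff ?_
  intro o a
  simp [pre]

lemma Semi.comap {δ : Type*} [Primcodable δ] {R : (ℕ → γ) → α → Prop} (h : Semi R) {φ : δ → γ}
    (hφ : Primrec φ) : Semi fun (o : ℕ → δ) a => R (fun i => φ (o i)) a := by
  obtain ⟨g, hg, h⟩ := h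
  have hmap : Primrec fun x : List δ × α => x.1.map φ :=
    Primrec.list_map Primrec.fst (hφ.comp Primrec.snd : Primrec fun x : (List δ × α) × δ => φ x.2)
  refine ⟨fun x => g (x.1.map φ, x.2), hg.comp (hmap.to_comp.pair Computable.snd), fun o a => ?_⟩
  simp [h]
  simp [pre, Function.comp_def]

end Semi

/-! ### Associates -/

section Associates

variable {α γ : Type*} [Primcodable α] [Primcodable γ]

/-- The first decided answer of the associate `p` on input `q` to the question for the `n`-th digit
is `v`. -/
def EtaDigit (p q : Baire) (n v : ℕ) : Prop :=
  ∃ m, answer p q n m = v + 1 ∧ ∀ m' < m, answer p q n m' = 0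

/-- `EtaDigit` makes sense even where `eta p q` is undefined. It can therefore occur inside
semidecidable conditions before convergence is known. -/
lemma etaDigit_iff {p q s : Baire} (hs : s ∈ eta p q) (n v : ℕ) : EtaDigit p q n v ↔ s n = v := by
  classical
  obtain ⟨h, rfl⟩ := hs
  have h0 := Nat.find_spec (h n)
  have h1 := fun {m} => Nat.find_min (h n) (m := m)
  simp only [eta]
  constructor
  · rintro ⟨m, hm, hm'⟩
    have : Nat.find (h n) = m := by
      rw [Nat.find_eq_iff]
      exact ⟨by omega, fun k hk => by simpa using hm' k hk⟩
    rw [this, hm]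
    rfl
  · rintro rfl
    exact ⟨Nat.find (h n), by omega, fun m' hm' => by simpa using h1 hm'⟩

lemma exists_mem_eta {p q : Baire} {R : ℕ → ℕ → Prop}
    (hR : ∀ n m v, answer p q n m = v + 1 → R n v) (hd : ∀ n, ∃ m, answer p q n m ≠ 0) :
    ∃ s ∈ eta p q, ∀ n, R n (s n) := by
  classical
  refine ⟨_, ⟨hd, rfl⟩, fun n => hR n (Nat.find (hd n)) _ ?_⟩
  have := Nat.find_spec (hd n)
  simp only [eta]
  omega

/-- Only the graph of `q` is available, so the prefix of `q` is guessed as a list and then verified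
entry by entry. -/
lemma Semi.answer {p q : (ℕ → γ) → α → Baire}
    (hp : Semi fun o (x : α × ℕ × ℕ) => p o x.1 x.2.1 = x.2.2)
    (hq : Semi fun o (x : α × ℕ × ℕ) => q o x.1 x.2.1 = x.2.2) :
    Semi fun o (x : α × ℕ × ℕ × ℕ) => answer (p o x.1) (q o x.1) x.2.1 x.2.2.1 = x.2.2.2 := by
  have h1 : Semi (γ := γ) fun o (x : ((α × ℕ × ℕ × ℕ) × List ℕ) × ℕ) =>
      q o x.1.1.1 x.2 = x.1.2.getD x.2 0 :=
    hq.comp (f := fun x : ((α × ℕ × ℕ × ℕ) × List ℕ) × ℕ => (x.1.1.1, x.2, x.1.2.getD x.2 0))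
      (Computable.pair (Computable.fst.comp (Computable.fst.comp Computable.fst))
        (Computable.pair Computable.snd ((Primrec.list_getD 0).to_comp.comp
          (Computable.snd.comp Computable.fst) Computable.snd)))
  have h2 := h1.forall_lt (n := fun x => x.1.2.2.1) (Computable.fst.comp (Computable.snd.comp
    (Computable.snd.comp Computable.fst)))
  have h3 : Semi (γ := γ) fun o (x : (α × ℕ × ℕ × ℕ) × List ℕ) => x.2.length = x.1.2.2.1 :=
    Semi.eq (Computable.list_length.comp Computable.snd) (Computable.fst.comp (Computable.snd.comp
    (Computable.snd.comp Computable.fst)))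
  have h4 : Semi (γ := γ) fun o (x : (α × ℕ × ℕ × ℕ) × List ℕ) =>
      p o x.1.1 (Nat.pair x.1.2.1 (Encodable.encode x.2)) = x.1.2.2.2 :=
    hp.comp (f := fun x : (α × ℕ × ℕ × ℕ) × List ℕ => (x.1.1,
      (Nat.pair x.1.2.1 (Encodable.encode x.2)), x.1.2.2.2))
      (Computable.pair (Computable.fst.comp Computable.fst)
        (Computable.pair (Primrec₂.natPair.to_comp.comp (Computable.fst.comp (Computable.snd.comp
          Computable.fst)) (Computable.encode.comp Computable.snd))
          (Computable.snd.comp (Computable.snd.comp (Computable.snd.comp Computable.fst)))))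
  refine ((h2.and h3).and h4).exists.of_iff fun o x => ?_
  obtain ⟨a, n, m, v⟩ := x
  simp only [TTE.answer]
  constructor
  · intro h
    exact ⟨(List.range m).map (q o a), ⟨by intro i hi; simp [hi], by simp⟩, h⟩
  · rintro ⟨l, ⟨h1, h2⟩, h3⟩
    have : (List.range m).map (q o a) = l := by
      apply List.ext_getElem
      · simp [h2]
      · intro i hi hi'
        simp only [List.length_map, List.length_range] at hi
        simp [h1 i hi, hi']
    rwa [this]

lemma Semi.etaDigit {p q : (ℕ → γ) → α → Baire}
    (hp : Semi fun o (x : α × ℕ × ℕ) => p o x.1 x.2.1 = x.2.2)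
    (hq : Semi fun o (x : α × ℕ × ℕ) => q o x.1 x.2.1 = x.2.2) :
    Semi fun o (x : α × ℕ × ℕ) => EtaDigit (p o x.1) (q o x.1) x.2.1 x.2.2 := by
  have h := Semi.answer hp hq
  have h1 := h.comp (f := fun x : (α × ℕ × ℕ) × ℕ => (x.1.1, x.1.2.1, x.2, x.1.2.2 + 1))
    (Computable.pair (Computable.fst.comp Computable.fst) (Computable.pair (Computable.fst.comp
      (Computable.snd.comp Computable.fst)) (Computable.pair Computable.snd (Computable.succ.comp
      (Computable.snd.comp (Computable.snd.comp Computable.fst))))))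
  have h2 := h.comp (f := fun x : ((α × ℕ × ℕ) × ℕ) × ℕ => (x.1.1.1, x.1.1.2.1, x.2, 0))
    (Computable.pair (Computable.fst.comp (Computable.fst.comp Computable.fst))
      (Computable.pair (Computable.fst.comp
      (Computable.snd.comp (Computable.fst.comp Computable.fst)))
      (Computable.pair Computable.snd (Computable.const 0))))
  exact (h1.and (h2.forall_lt Computable.snd)).exists

/-- The associate that answers `v + 1` to the question for the `n`-th digit, when it has read
`⟨w, v⟩` digits and these suffice to recognize by `g` that `v` is admissible. -/
def selector (g : List ℕ × ℕ × ℕ → Bool) : Baire := fun i =>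
  let l : List ℕ := (Encodable.decode i.unpair.2).getD []
  bif g (l, i.unpair.1, l.length.unpair.2) then l.length.unpair.2 + 1 else 0

lemma answer_selector (g : List ℕ × ℕ × ℕ → Bool) (q : Baire) (n m : ℕ) :
    answer (selector g) q n m = bif g (pre q m, n, m.unpair.2) then m.unpair.2 + 1 else 0 := by
  simp [answer, selector, pre]

/-- A relation `R` that is semidecidable relative to the oracle has a computable choice
function. -/
lemma Semi.exists_realizer {R : Baire → ℕ × ℕ → Prop} (hR : Semi R) :
    ∃ e : Baire, Computable e ∧ ∀ r, (∀ n, ∃ v, R r (n, v)) →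
      ∃ s ∈ eta e r, ∀ n, R r (n, s n) := by
  obtain ⟨g, hg, h, hm⟩ := hR.exists_monotone
  refine ⟨selector g, ?_, fun r hr => ?_⟩
  · have hl : Computable fun i : ℕ => (Encodable.decode (α := List ℕ) i.unpair.2).getD [] :=
      Computable.option_getD (Computable.decode.comp (Computable.snd.comp Computable.unpair))
        (Computable.const [])
    have hv := Computable.snd.comp (Computable.unpair.comp (Computable.list_length.comp hl))
    exact Computable.cond (hg.comp (hl.pair ((Computable.fst.comp Computable.unpair).pair hv)))
      (Computable.succ.comp hv) (Computable.const 0)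
  · refine exists_mem_eta (R := fun n v => R r (n, v)) (fun n m v hv => ?_) fun n => ?_
    · rw [answer_selector] at hv
      cases hb : g (pre r m, n, m.unpair.2) <;> simp only [hb, cond_true, cond_false] at hv
      · omega
      · obtain rfl : m.unpair.2 = v := by omega
        exact (h _ _).2 ⟨m, hb⟩
    · obtain ⟨v, hv⟩ := hr n
      obtain ⟨w, hw⟩ := (h _ _).1 hv
      -- A prefix of this length proposes the value `v` and is long enough for stage `w`.
      refine ⟨Nat.pair w v, ?_⟩
      rw [answer_selector]
      simp [hm _ _ _ _ (Nat.left_le_pair w v) hw]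

/-- The list of pairs of corresponding entries of two lists. -/
def zipPad (l l' : List ℕ) : List (ℕ × ℕ) :=
  (List.range l'.length).map fun i => (l.getD i 0, l'.getD i 0)

lemma zipPad_pre (r q : Baire) (m : ℕ) :
    zipPad (pre r m) (pre q m) = pre (fun i => (r i, q i)) m := by
  simp only [zipPad, length_pre]
  apply List.map_congr_left
  intro i hi
  simp only [List.mem_range] at hi
  simp [pre, hi]

lemma computable_zipPad : Computable₂ zipPad := by
  apply Primrec₂.to_comp
  refine Primrec.list_map (Primrec.list_range.comp (Primrec.list_length.comp Primrec.snd)) ?_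
  exact Primrec.pair ((Primrec.list_getD 0).comp (Primrec.fst.comp Primrec.fst) Primrec.snd)
    ((Primrec.list_getD 0).comp (Primrec.snd.comp Primrec.fst) Primrec.snd)

/-- A relation that is semidecidable relative to a pair of oracles `r`, `q` has an associate in `q`
that is computable in `r`. -/
lemma Semi.exists_associate {R : (ℕ → ℕ × ℕ) → ℕ × ℕ → Prop} (hR : Semi R) :
    ∃ Q : Baire → Baire, (Semi fun r (x : ℕ × ℕ) => Q r x.1 = x.2) ∧
      ∀ r q, (∀ n, ∃ v, R (fun i => (r i, q i)) (n, v)) →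
        ∃ s ∈ eta (Q r) q, ∀ n, R (fun i => (r i, q i)) (n, s n) := by
  obtain ⟨g, hg, h, hm⟩ := hR.exists_monotone
  let len : ℕ → List ℕ := fun i => (Encodable.decode (α := List ℕ) i.unpair.2).getD []
  have hl : Computable len :=
      Computable.option_getD (Computable.decode.comp (Computable.snd.comp Computable.unpair))
        (Computable.const [])
  -- The answer uses only as many digits of `r` as the question contains digits of `q`, so each
  -- entry of the associate depends on a finite prefix of `r`.
  refine ⟨fun r => selector fun x => g (zipPad (pre r x.1.length) x.1, x.2), ?_, fun r q hr => ?_⟩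
  · have hv := Computable.snd.comp (Computable.unpair.comp (Computable.list_length.comp hl))
    have hh : Computable fun x : List ℕ × ℕ =>
        bif g (zipPad x.1 (len x.2), x.2.unpair.1, (len x.2).length.unpair.2)
        then (len x.2).length.unpair.2 + 1 else 0 :=
      Computable.cond (hg.comp (Computable.pair (computable_zipPad.comp Computable.fst
          (hl.comp Computable.snd)) (Computable.pair
          (Computable.fst.comp (Computable.unpair.comp Computable.snd))
          (hv.comp Computable.snd))))
        (Computable.succ.comp (hv.comp Computable.snd)) (Computable.const 0)
    exact Semi.graph (γ := ℕ) (s := fun i => (len i).length) (Computable.list_length.comp hl) hh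
  · refine exists_mem_eta (R := fun n v => R (fun i => (r i, q i)) (n, v))
      (fun n m v hv => ?_) fun n => ?_
    · rw [answer_selector, length_pre, zipPad_pre] at hv
      cases hb : g (pre (fun i => (r i, q i)) m, n, m.unpair.2) <;>
        simp only [hb, cond_true, cond_false] at hv
      · omega
      · obtain rfl : m.unpair.2 = v := by omega
        exact (h _ _).2 ⟨m, hb⟩
    · obtain ⟨v, hv⟩ := hr n
      obtain ⟨w, hw⟩ := (h _ _).1 hv
      refine ⟨Nat.pair w v, ?_⟩
      rw [answer_selector, length_pre, zipPad_pre]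
      simp [hm _ _ _ _ (Nat.left_le_pair w v) hw]

/-- A condition `R o j` that is semidecidable relative to the oracle can be listed: the value `c j`
appears (shifted by one) in the `j`-th component of `t o` iff `R o j` holds. -/
lemma Semi.exists_listing {R : Baire → ℕ → Prop} (hR : Semi R) {c : ℕ → ℕ} (hc : Computable c) :
    ∃ t : Baire → Baire, (Semi fun r (x : ℕ × ℕ) => t r x.1 = x.2) ∧
      ∀ r j, (∀ k, component (t r) j k = 0 ∨ component (t r) j k = c j + 1) ∧
        (R r j ↔ ∃ k, component (t r) j k = c j + 1) := by
  obtain ⟨g, hg, h⟩ := hR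
  refine ⟨fun r (i : ℕ) => bif g (pre r i.unpair.2, i.unpair.1) then c i.unpair.1 + 1 else 0, ?_, ?_⟩
  · refine Semi.graph (γ := ℕ) (s := fun i : ℕ => i.unpair.2) (Computable.snd.comp Computable.unpair)
      (h := fun x : List ℕ × ℕ => bif g (x.1, x.2.unpair.1) then c x.2.unpair.1 + 1 else 0) ?_
    have := Computable.fst.comp (Computable.unpair.comp (Computable.snd (α := List ℕ) (β := ℕ)))
    exact Computable.cond (hg.comp (Computable.fst.pair this)) (Computable.succ.comp (hc.comp this))
      (Computable.const 0)
  · intro r j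
    simp only [component, Nat.unpair_pair, h]
    constructor
    · intro k
      cases g (pre r k, j) <;> simp
    · refine exists_congr fun k => ?_
      cases g (pre r k, j) <;> simp

end Associates

/-! ### Names of points -/

section Points

variable {X : Type*} [MetricSpace X] {ν : ℕ → X}

lemma cauchyRep.dist_le {p : Baire} {x : X} (h : cauchyRep ν p x) (m : ℕ) :
    dist (ν (p m)) x ≤ (2 : ℝ)⁻¹ ^ m := by
  have h1 : Filter.Tendsto (fun i => dist (ν (p m)) (ν (p i))) Filter.atTop
      (nhds (dist (ν (p m)) x)) := tendsto_const_nhds.dist h.2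
  refine le_of_tendsto h1 (Filter.eventually_atTop.2 ⟨m, fun i hi => ?_⟩)
  simpa [min_eq_left hi] using (h.1 m i).le

/-- Two errors of at most a quarter add up to a half, which leaves room for the strict inequality in
the Cauchy condition. -/
lemma cauchyRep_of_dist_le {s : Baire} {y : X} (h : ∀ n, dist (ν (s n)) y ≤ (2 : ℝ)⁻¹ ^ (n + 2)) :
    cauchyRep ν s y := by
  constructor
  · intro i j
    have hle : ∀ k l : ℕ, l ≤ k → (2 : ℝ)⁻¹ ^ (k + 2) ≤ (2 : ℝ)⁻¹ ^ l / 4 := by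
      intro k l hl
      have : (2 : ℝ)⁻¹ ^ k ≤ (2 : ℝ)⁻¹ ^ l := pow_le_pow_of_le_one (by norm_num) (by norm_num) hl
      rw [pow_add]
      linarith
    have h1 := hle i _ (min_le_left i j)
    have h2 := hle j _ (min_le_right i j)
    have h3 := dist_triangle_right (ν (s i)) (ν (s j)) y
    have h4 : (0 : ℝ) < (2 : ℝ)⁻¹ ^ min i j := by positivity
    linarith [h i, h j]
  · rw [tendsto_iff_dist_tendsto_zero]
    refine squeeze_zero (fun _ => dist_nonneg) h ?_
    exact (tendsto_pow_atTop_nhds_zero_of_lt_one (by norm_num) (by norm_num)).comp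
      (Filter.tendsto_add_atTop_nat 2)

lemma cauchyRep_const (a : ℕ) : cauchyRep ν (fun _ => a) (ν a) :=
  ⟨fun i j => by simp, tendsto_const_nhds⟩

lemma exists_pow_lt {ε : ℝ} (h : 0 < ε) : ∃ m : ℕ, (2 : ℝ)⁻¹ ^ m < ε :=
  exists_pow_lt_of_lt_one h (by norm_num)

/-- Strict upper bounds on a distance can be recognized from names of the two points. -/
lemma dist_lt_iff_exists_approx {p : Baire} {x y : X} (h : cauchyRep ν p x) {ε : ℝ} :
    dist y x < ε ↔ ∃ m, dist y (ν (p m)) + (2 : ℝ)⁻¹ ^ m < ε := by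
  constructor
  · intro hlt
    obtain ⟨m, hm⟩ := exists_pow_lt (ε := (ε - dist y x) / 2) (by linarith)
    refine ⟨m, ?_⟩
    have := h.dist_le m
    have := dist_triangle_right y (ν (p m)) x
    linarith
  · rintro ⟨m, hm⟩
    have := h.dist_le m
    have := dist_triangle y (ν (p m)) x
    linarith

end Points

/-! ### Semidecidable relations between points of the dense sequence -/

section Metric

variable {X : Type*} [MetricSpace X] {ν : ℕ → X} {α γ : Type*} [Primcodable α] [Primcodable γ]

lemma computable_two_pow {f : α → ℕ} (hf : Computable f) : Computable fun a => 2 ^ f a := by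
  have : Primrec fun n : ℕ => 2 ^ n := by
    refine (Primrec.nat_rec₁ (f := fun _ b => 2 * b) 1
      (Primrec.nat_mul.comp (Primrec.const 2) Primrec.snd)).of_eq fun n => ?_
    induction n with
    | zero => rfl
    | succ n ih => simp only [ih, pow_succ]; ring
  exact this.to_comp.comp hf

lemma computable_mul {f g : α → ℕ} (hf : Computable f) (hg : Computable g) :
    Computable fun a => f a * g a := Primrec.nat_mul.to_comp.comp hf hg

lemma computable_add {f g : α → ℕ} (hf : Computable f) (hg : Computable g) :
    Computable fun a => f a + g a := Primrec.nat_add.to_comp.comp hf hg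

lemma computable_unpair_fst {f : α → ℕ} (hf : Computable f) : Computable fun a => (f a).unpair.1 :=
  Computable.fst.comp (Computable.unpair.comp hf)

lemma computable_unpair_snd {f : α → ℕ} (hf : Computable f) : Computable fun a => (f a).unpair.2 :=
  Computable.snd.comp (Computable.unpair.comp hf)

/-- A strict inequality for `d` holds iff some rational approximation confirms it with its error
added. Clearing denominators and moving negative terms leaves a comparison of natural numbers. -/
lemma mul_add_lt_iff_exists {d : ℝ} {a b c : ℕ → ℕ}
    (h : ∀ m, |d - ((a m : ℝ) - b m) / (c m + 1)| < (2 : ℝ)⁻¹ ^ m) (v w u : ℕ) :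
    d * v + w < u ↔ ∃ m, a m * v * 2 ^ m + v * (c m + 1) + w * (c m + 1) * 2 ^ m <
      u * (c m + 1) * 2 ^ m + b m * v * 2 ^ m := by
  have key : ∀ m, a m * v * 2 ^ m + v * (c m + 1) + w * (c m + 1) * 2 ^ m <
      u * (c m + 1) * 2 ^ m + b m * v * 2 ^ m ↔
      ((a m : ℝ) - b m) / (c m + 1) * v + v * (2 : ℝ)⁻¹ ^ m + w < u := by
    intro m
    have hc : (0 : ℝ) < (c m + 1 : ℝ) := by positivity
    have h2 : (0 : ℝ) < (2 : ℝ) ^ m := by positivity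
    rw [← Nat.cast_lt (α := ℝ)]
    push_cast
    refine Iff.trans ?_ (mul_lt_mul_iff_left₀ (mul_pos hc h2))
    have e : (((a m : ℝ) - b m) / (c m + 1) * v + v * (2 : ℝ)⁻¹ ^ m + w) * ((c m + 1) * 2 ^ m) =
        (a m - b m) * v * 2 ^ m + v * (c m + 1) + w * (c m + 1) * 2 ^ m := by
      rw [inv_pow]
      field_simp
    rw [e]
    constructor <;> intro h <;> linarith
  simp only [key]
  have hv : (0 : ℝ) ≤ v := v.cast_nonneg
  constructor
  · intro hlt
    obtain ⟨m, hm⟩ := exists_pow_lt (ε := (u - (d * v + w)) / (2 * (v + 1)))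
      (div_pos (by linarith) (by positivity))
    refine ⟨m, ?_⟩
    rw [lt_div_iff₀ (by positivity)] at hm
    have h1 := mul_le_mul_of_nonneg_right (abs_lt.1 (h m)).1.le hv
    have h2 : (0 : ℝ) < (2 : ℝ)⁻¹ ^ m := by positivity
    nlinarith
  · rintro ⟨m, hm⟩
    have h1 := mul_le_mul_of_nonneg_right (abs_lt.1 (h m)).2.le hv
    linarith

lemma Semi.dist_lt (hX : IsComputableMetricSpace ν) {i j v w u : α → ℕ} (hi : Computable i)
    (hj : Computable j) (hv : Computable v) (hw : Computable w) (hu : Computable u) :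
    Semi fun (_ : ℕ → γ) a => dist (ν (i a)) (ν (j a)) * (v a : ℝ) + (w a : ℝ) < (u a : ℝ) := by
  obtain ⟨f, hf, h⟩ := hX.dist_computable
  let F : α × ℕ → ℕ := fun x => f (i x.1, j x.1, x.2)
  have hF : Computable F := hf.comp ((hi.comp Computable.fst).pair
    ((hj.comp Computable.fst).pair Computable.snd))
  have ha := computable_unpair_fst (computable_unpair_fst hF)
  have hb := computable_unpair_snd (computable_unpair_fst hF)
  have hc := Computable.succ.comp (computable_unpair_snd hF)
  have h2 := computable_two_pow (Computable.snd (α := α) (β := ℕ))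
  have hv' := hv.comp (Computable.fst (α := α) (β := ℕ))
  have hw' := hw.comp (Computable.fst (α := α) (β := ℕ))
  have hu' := hu.comp (Computable.fst (α := α) (β := ℕ))
  refine (Semi.lt (γ := γ) (computable_add (computable_add (computable_mul (computable_mul ha hv') h2)
    (computable_mul hv' hc)) (computable_mul (computable_mul hw' hc) h2))
    (computable_add (computable_mul (computable_mul hu' hc) h2)
      (computable_mul (computable_mul hb hv') h2))).exists.of_iff fun o a => ?_
  refine mul_add_lt_iff_exists (d := dist (ν (i a)) (ν (j a)))
    (a := fun m => (F (a, m)).unpair.1.unpair.1) (b := fun m => (F (a, m)).unpair.1.unpair.2)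
    (c := fun m => (F (a, m)).unpair.2) (fun m => ?_) _ _ _
  have := h (i a) (j a) m
  simpa [nuQ, F] using this

end Metric

/-! ### Retractions from disjoint covers of the complement -/

section Retraction

variable {X : Type*} [MetricSpace X]

/-- Disjointness makes `F` constant on each piece within `A`. The bound by `infDist` forces `F x`
towards `x` as `x` approaches `B`, which gives continuity there. -/
lemma exists_retraction {A B : Set X} {z : ℕ → X} (hz : ∀ j, z j ∈ B)
    {W : ℕ → Opens X} (hW : ∀ i j, i ≠ j → (W i : Set X) ∩ W j = ∅)
    (hcov : (⋃ i, (W i : Set X)) ∩ A = A \ B)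
    (hclose : ∀ j, ∀ x ∈ W j, dist x (z j) ≤ 5 * Metric.infDist x B) :
    ∃ F : X → X, ContinuousOn F A ∧ (∀ x ∈ A, F x ∈ B) ∧ (∀ x ∈ B, F x = x) ∧
      (∀ x ∈ A, ∀ j, x ∈ W j → F x = z j) ∧ ∀ x ∈ A, dist x (F x) ≤ 5 * Metric.infDist x B := by
  classical
  let F : X → X := fun x => if h : x ∉ B ∧ ∃ j, x ∈ W j then z h.2.choose else x
  have hWB : ∀ x ∈ A, ∀ j, x ∈ W j → x ∉ B := fun x hx j hj =>
    (hcov.subset ⟨mem_iUnion.2 ⟨j, hj⟩, hx⟩).2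
  have hFB : ∀ x ∈ B, F x = x := fun x hx => dif_neg fun h => h.1 hx
  have hFW : ∀ x ∈ A, ∀ j, x ∈ W j → F x = z j := by
    intro x hx j hj
    have h : x ∉ B ∧ ∃ j, x ∈ W j := ⟨hWB x hx j hj, j, hj⟩
    simp only [F, dif_pos h]
    by_contra hne
    have : x ∈ (W h.2.choose : Set X) ∩ W j := ⟨h.2.choose_spec, hj⟩
    rw [hW _ _ (fun e => hne (by rw [e]))] at this
    exact this
  have hcases : ∀ x ∈ A, x ∈ B ∨ ∃ j, x ∈ W j := by
    intro x hx
    by_cases h : x ∈ B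
    · exact Or.inl h
    · obtain ⟨j, hj⟩ := mem_iUnion.1 (hcov.symm.subset ⟨hx, h⟩).1
      exact Or.inr ⟨j, hj⟩
  have hdist : ∀ x ∈ A, dist x (F x) ≤ 5 * Metric.infDist x B := by
    intro x hx
    rcases hcases x hx with h | ⟨j, hj⟩
    · rw [hFB x h, dist_self]
      exact mul_nonneg (by norm_num) Metric.infDist_nonneg
    · rw [hFW x hx j hj]
      exact hclose j x hj
  refine ⟨F, fun x hx => ?_, fun x hx => ?_, hFB, hFW, hdist⟩
  · rcases hcases x hx with h | ⟨j, hj⟩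
    · rw [Metric.continuousWithinAt_iff]
      intro ε hε
      -- `d(F y, x) ≤ d(y, F y) + d(y, x) ≤ 5 d(y, x) + d(y, x)`.
      refine ⟨ε / 6, by linarith, fun {y} hy hyx => ?_⟩
      rw [hFB x h]
      have h1 := hdist y hy
      have h2 := Metric.infDist_le_dist_of_mem (x := y) h
      have h3 := dist_triangle_left (F y) x y
      linarith
    · refine (continuousWithinAt_const (b := z j)).congr_of_eventuallyEq ?_ (hFW x hx j hj)
      filter_upwards [mem_nhdsWithin_of_mem_nhds ((W j).isOpen.mem_nhds hj), self_mem_nhdsWithin]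
        with y hy hyA using hFW y hyA j hy
  · rcases hcases x hx with h | ⟨j, hj⟩
    · rwa [hFB x h]
    · rw [hFW x hx j hj]
      exact hz j

lemma retract_of_continuousOn {A B : Closeds X} (hBA : (B : Set X) ⊆ A) {F : X → X}
    (hF : ContinuousOn F A) (hFA : ∀ x ∈ A, F x ∈ B) (hFB : ∀ x ∈ B, F x = x) :
    PFun.res F (A : Set X) ∈ retract (A, B) := by
  refine ⟨⟨A.isClosed, continuousOn_iff_continuous_domRestrict.1 hF⟩, ?_, ?_, rfl⟩
  · ext y
    constructor
    · rintro ⟨x, hx⟩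
      obtain ⟨hxA, rfl⟩ := (PFun.mem_res _ _ _ _).1 hx
      exact hFA x hxA
    · exact fun hy => ⟨y, (PFun.mem_res _ _ _ _).2 ⟨hBA hy, hFB y hy⟩⟩
  · exact fun b hb => (PFun.mem_res _ _ _ _).2 ⟨hBA hb, hFB b hb⟩

end Retraction

/-! ### Lower bounds on the distance to `B` -/

section DistanceFunction

variable {X : Type*} [MetricSpace X] {ν : ℕ → X}

lemma coe_lt_distTo_iff {B : Closeds X} (hB : (B : Set X).Nonempty) (x : X) {q : ℝ} :
    (q : EReal) < distTo B x ↔ q < Metric.infDist x B := by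
  rw [distTo, Metric.infDist, ← EReal.coe_ennreal_toReal (Metric.infEDist_ne_top hB),
    EReal.coe_lt_coe_iff]

/-- The constant sequence `a` is a name of `ν a`, so the distance name can be evaluated at it. The
`+ 1` is the shift in the enumeration of lower bounds. -/
lemma lt_infDist_iff_etaDigit {B : Closeds X} (hB : (B : Set X).Nonempty) {p : Baire}
    (hp : distRep ν p B) (a n : ℕ) :
    ((nuQ n : ℚ) : ℝ) < Metric.infDist (ν a) B ↔ ∃ s, EtaDigit p (fun _ => a) s (n + 1) := by
  obtain ⟨o, ho, y, rfl, h⟩ := hp (ν a) (mem_univ _) _ (cauchyRep_const a)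
  simp only [etaDigit_iff ho]
  rw [← coe_lt_distTo_iff hB]
  have : n ∈ {n : ℕ | (((nuQ n : ℚ) : ℝ) : EReal) < distTo B (ν a)} ↔ _ := Set.ext_iff.1 h n
  simp only [mem_ofPred_eq] at this
  rw [this]
  exact exists_congr fun i => by omega

end DistanceFunction

/-! ### Names of pairs -/

section Interleave

variable {γ : Type*} [Primcodable γ]

/-- The name `⟨p, q⟩ = p₀ q₀ p₁ q₁ …`. -/
def interleave (p q : Baire) : Baire := fun i => if i % 2 = 0 then p (i / 2) else q (i / 2)

@[simp] lemma left_interleave (p q : Baire) : left (interleave p q) = p := by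
  funext n
  simp [left, interleave]

@[simp] lemma right_interleave (p q : Baire) : right (interleave p q) = q := by
  funext n
  have h1 : (2 * n + 1) % 2 = 1 := by omega
  have h2 : (2 * n + 1) / 2 = n := by omega
  simp [right, interleave, h1, h2]

lemma Semi.interleave {R S : (ℕ → γ) → ℕ × ℕ → Prop} (hR : Semi R) (hS : Semi S) :
    Semi fun o (x : ℕ × ℕ) => if x.1 % 2 = 0 then R o (x.1 / 2, x.2) else S o (x.1 / 2, x.2) := by
  have hm : Computable fun x : ℕ × ℕ => x.1 % 2 :=
    (Primrec.nat_mod.comp Primrec.fst (Primrec.const 2)).to_comp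
  have hd : Computable fun x : ℕ × ℕ => (x.1 / 2, x.2) :=
    Computable.pair (Primrec.nat_div.comp Primrec.fst (Primrec.const 2)).to_comp Computable.snd
  refine (((Semi.eq hm (Computable.const 0)).and (hR.comp hd)).or
    ((Semi.eq hm (Computable.const 1)).and (hS.comp hd))).of_iff fun o x => ?_
  rcases Nat.mod_two_eq_zero_or_one x.1 with h | h <;> simp [h]

lemma Semi.interleave_graph {p q : (ℕ → γ) → Baire} (hp : Semi fun o (x : ℕ × ℕ) => p o x.1 = x.2)
    (hq : Semi fun o (x : ℕ × ℕ) => q o x.1 = x.2) :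
    Semi fun o (x : ℕ × ℕ) => TTE.interleave (p o) (q o) x.1 = x.2 := by
  refine (hp.interleave hq).of_iff fun o x => ?_
  simp only [TTE.interleave]
  split_ifs <;> rfl

end Interleave

/-! ### Components of paired names -/

section Projections

variable {γ : Type*} [Primcodable γ] {p : (ℕ → γ) → Baire}

lemma Semi.left_graph (hp : Semi fun o (x : ℕ × ℕ) => p o x.1 = x.2) :
    Semi fun o (x : ℕ × ℕ) => left (p o) x.1 = x.2 :=
  hp.comp (f := fun x : ℕ × ℕ => (2 * x.1, x.2))
    (Computable.pair (Primrec.nat_double.to_comp.comp Computable.fst) Computable.snd)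

lemma Semi.right_graph (hp : Semi fun o (x : ℕ × ℕ) => p o x.1 = x.2) :
    Semi fun o (x : ℕ × ℕ) => right (p o) x.1 = x.2 :=
  hp.comp (f := fun x : ℕ × ℕ => (2 * x.1 + 1, x.2))
    (Computable.pair (Primrec.nat_double_succ.to_comp.comp Computable.fst) Computable.snd)

lemma Semi.id_graph : Semi fun (r : Baire) (x : ℕ × ℕ) => r x.1 = x.2 :=
  Semi.lookup Computable.fst Computable.snd

end Projections

/-! ### The cover of the complement of `B` -/

section Cover

variable {X : Type*} [MetricSpace X] (ν : ℕ → X)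

/-- For `j = ⟨⟨a, c⟩, k⟩`, where `c` codes the radius `ρ`: `2 ρ < d_B (ν a)`, and the distance of
`ν a` to the `k`-th point of `B` is less than `4 ρ`. Here `B` is given by the name `r`. -/
def Admissible (r : Baire) (j : ℕ) : Prop :=
  (∃ s, EtaDigit (right r) (fun _ => j.unpair.1.unpair.1) s
    (Nat.pair (Nat.pair (2 * (j.unpair.1.unpair.2.unpair.1 + 1)) 0)
      j.unpair.1.unpair.2.unpair.2 + 1)) ∧
  ∃ m y, left r (Nat.pair j.unpair.2 m) = y + 1 ∧
    dist (ν j.unpair.1.unpair.1) (ν y) *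
        (((j.unpair.1.unpair.2.unpair.2 + 1) * 2 ^ m : ℕ) : ℝ) +
      ((j.unpair.1.unpair.2.unpair.2 + 1 : ℕ) : ℝ) <
      ((4 * (j.unpair.1.unpair.2.unpair.1 + 1) * 2 ^ m : ℕ) : ℝ)

variable {ν}

lemma semi_admissible (hX : IsComputableMetricSpace ν) : Semi fun r j => Admissible ν (right r) j := by
  have hid : Semi fun (r : Baire) (x : ℕ × ℕ) => right r x.1 = x.2 := Semi.id_graph.right_graph
  have hj : Computable fun j : ℕ => j := Computable.id
  have ha := computable_unpair_fst (computable_unpair_fst hj)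
  have hc1 := computable_unpair_fst (computable_unpair_snd (computable_unpair_fst hj))
  have hc2 := computable_unpair_snd (computable_unpair_snd (computable_unpair_fst hj))
  have h1 : Semi fun (r : Baire) (x : ℕ × ℕ × ℕ) => 
      EtaDigit (right (right r)) (fun _ => x.1) x.2.1 x.2.2 :=
    Semi.etaDigit (p := fun r _ => right (right r)) (q := fun _ a _ => a)
      (hid.right_graph.comp Computable.snd)
      (Semi.eq Computable.fst (Computable.snd.comp Computable.snd))
  have h2 := h1.comp (f := fun x : ℕ × ℕ => (x.1.unpair.1.unpair.1, x.2,
      (Nat.pair (Nat.pair (2 * (x.1.unpair.1.unpair.2.unpair.1 + 1)) 0)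
      x.1.unpair.1.unpair.2.unpair.2 + 1)))
    (Computable.pair (ha.comp Computable.fst) (Computable.pair Computable.snd
      (Computable.succ.comp (Primrec₂.natPair.to_comp.comp (Primrec₂.natPair.to_comp.comp
        (Primrec.nat_double.to_comp.comp (Computable.succ.comp (hc1.comp Computable.fst)))
        (Computable.const 0)) (hc2.comp Computable.fst)))))
  have hj' : Computable fun x : (ℕ × ℕ) × ℕ => x.1.1 := Computable.fst.comp Computable.fst
  have hm' : Computable fun x : (ℕ × ℕ) × ℕ => x.1.2 := Computable.snd.comp Computable.fst
  have hy' : Computable fun x : (ℕ × ℕ) × ℕ => x.2 := Computable.snd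
  have h3 := hid.left_graph.comp (f := fun x : (ℕ × ℕ) × ℕ =>
      (Nat.pair x.1.1.unpair.2 x.1.2, x.2 + 1))
    (Computable.pair (Primrec₂.natPair.to_comp.comp (computable_unpair_snd hj') hm')
      (Computable.succ.comp hy'))
  have h4 := Semi.dist_lt (γ := ℕ) hX (ha.comp hj') hy'
    (computable_mul (Computable.succ.comp (hc2.comp hj')) (computable_two_pow hm'))
    (Computable.succ.comp (hc2.comp hj'))
    (computable_mul (computable_mul (Computable.const 4) (Computable.succ.comp (hc1.comp hj')))
      (computable_two_pow hm'))
  exact h2.exists.and (h3.and h4).exists.exists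

/-- The radius of the ideal ball with code `n`. -/
noncomputable def idealRadius (n : ℕ) : ℝ := ((nuQpos n.unpair.2 : ℚ) : ℝ)

lemma idealRadius_eq (n : ℕ) :
    idealRadius n = ((n.unpair.2.unpair.1 : ℝ) + 1) / ((n.unpair.2.unpair.2 : ℝ) + 1) := by
  simp [idealRadius, nuQpos]

lemma add_lt_div_iff (d a b C : ℝ) (hb : 0 < b) (m : ℕ) :
    d * (b * 2 ^ m) + b < C * a * 2 ^ m ↔ d + (2 : ℝ)⁻¹ ^ m < C * (a / b) := by
  have h2 : (0 : ℝ) < (2 : ℝ) ^ m := by positivity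
  refine Iff.trans ?_ (mul_lt_mul_iff_left₀ (mul_pos hb h2))
  have e1 : (d + (2 : ℝ)⁻¹ ^ m) * (b * 2 ^ m) = d * (b * 2 ^ m) + b := by
    rw [inv_pow]; field_simp
  have e2 : C * (a / b) * (b * 2 ^ m) = C * a * 2 ^ m := by field_simp
  rw [e1, e2]

lemma admissible_iff {r : Baire} {B : Closeds X} (hB : (B : Set X).Nonempty)
    (hr : distRep ν (right r) B) (h0 : ∀ i k, 1 ≤ component (left r) i k) {z : ℕ → X}
    (hz : ∀ i, cauchyRep ν (fun k => component (left r) i k - 1) (z i)) (j : ℕ) :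
    Admissible ν r j ↔ 2 * idealRadius j.unpair.1 < Metric.infDist (ν j.unpair.1.unpair.1) B ∧
      dist (ν j.unpair.1.unpair.1) (z j.unpair.2) < 4 * idealRadius j.unpair.1 := by
  refine and_congr ?_ ?_
  -- The rational code used in `Admissible` is a `nuQ`-code of twice the radius.
  · rw [← lt_infDist_iff_etaDigit hB hr, idealRadius_eq]
    simp [nuQ, mul_div_assoc]
  · rw [dist_lt_iff_exists_approx (hz j.unpair.2)]
    refine exists_congr fun m => ?_
    have h1 := h0 j.unpair.2 m
    simp only [component] at h1 ⊢
    rw [idealRadius_eq, ← add_lt_div_iff _ _ _ _ (by positivity)]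
    constructor
    · rintro ⟨y, hy, h⟩
      rw [hy]
      simpa using h
    · intro h
      refine ⟨left r (Nat.pair j.unpair.2 m) - 1, by omega, ?_⟩
      push_cast
      simpa using h

/-- The cover of the complement of `B` by the admissible balls. -/
def admissibleCover (ν : ℕ → X) (r : Baire) (j : ℕ) : Opens X :=
  ⟨{x | Admissible ν r j ∧ x ∈ idealBall ν j.unpair.1},
    isOpen_const.inter Metric.isOpen_ball⟩

/-- An admissible ball misses `B` because its radius is less than half of `d_B(a)`. Conversely, for
`D = d_B(x) > 0`, take `a` within `D/12` of `x` and `ρ` between `D/3` and `5D/12`. Then `2ρ < 11D/12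
< d_B(a)`, and some `z k` is within `7D/6 < 4ρ` of `a`. -/
lemma iUnion_admissibleCover {r : Baire} (hX : IsComputableMetricSpace ν) {B : Closeds X}
    (hB : (B : Set X).Nonempty)
    (hr : distRep ν (right r) B) (h0 : ∀ i k, 1 ≤ component (left r) i k) {z : ℕ → X}
    (hz : ∀ i, cauchyRep ν (fun k => component (left r) i k - 1) (z i))
    (hd : (B : Set X) ⊆ closure (range z)) :
    (⋃ j, (admissibleCover ν r j : Set X)) = (B : Set X)ᶜ := by
  ext x
  simp only [mem_iUnion, admissibleCover, Opens.coe_mk, mem_ofPred_eq, admissible_iff hB hr h0 hz,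
    mem_compl_iff]
  constructor
  · rintro ⟨j, ⟨h1, -⟩, h2⟩ hxB
    have h3 : dist x (ν j.unpair.1.unpair.1) < idealRadius j.unpair.1 := h2
    have h4 := Metric.infDist_le_dist_of_mem (x := ν j.unpair.1.unpair.1) hxB
    rw [dist_comm] at h4
    have := dist_nonneg (x := x) (y := ν j.unpair.1.unpair.1)
    linarith
  · intro hx
    have hpos : 0 < Metric.infDist x B := (B.isClosed.notMem_iff_infDist_pos hB).1 hx
    set D := Metric.infDist x B
    -- Multiples of `1/(N+1)` then have spacing below `D/24`, so one of them falls into the window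
    -- of width `D/12` for the radius.
    obtain ⟨N, hN⟩ := exists_nat_gt (24 / D)
    have hN0 : (0 : ℝ) < N := lt_trans (by positivity) hN
    obtain ⟨M, hM1, hM2⟩ : ∃ M : ℕ, D / 3 < ((M : ℝ) + 1) / ((N : ℝ) + 1) ∧
        ((M : ℝ) + 1) / ((N : ℝ) + 1) < D * (5 / 12) := by
      have h24 : 24 < N * D := by rwa [div_lt_iff₀ hpos] at hN
      refine ⟨⌊D * (1 / 3) * (N + 1)⌋₊, ?_, ?_⟩
      · rw [lt_div_iff₀ (by positivity)]
        have := Nat.lt_floor_add_one (D * (1 / 3) * (N + 1))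
        nlinarith
      · rw [div_lt_iff₀ (by positivity)]
        have := Nat.floor_le (a := D * (1 / 3) * (N + 1)) (by positivity)
        nlinarith
    obtain ⟨a, ha⟩ := hX.dense.exists_dist_lt x (ε := D / 12) (by positivity)
    have h1 : D ≤ Metric.infDist (ν a) B + dist x (ν a) := Metric.infDist_le_infDist_add_dist
    have h2 : Metric.infDist (ν a) B ≤ D + dist (ν a) x := Metric.infDist_le_infDist_add_dist
    rw [dist_comm] at h2
    have h3 : Metric.infDist (ν a) (range z) ≤ Metric.infDist (ν a) B := by
      rw [← Metric.infDist_closure]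
      exact Metric.infDist_le_infDist_of_subset hd hB
    obtain ⟨_, ⟨k, rfl⟩, hk⟩ := (Metric.infDist_lt_iff (range_nonempty z)).1
      (show Metric.infDist (ν a) (range z) < 14 / 12 * D by linarith)
    have hρ : idealRadius (Nat.pair a (Nat.pair M N)) = ((M : ℝ) + 1) / ((N : ℝ) + 1) := by
      simp [idealRadius_eq]
    refine ⟨Nat.pair (Nat.pair a (Nat.pair M N)) k, ?_⟩
    simp only [Nat.unpair_pair, hρ]
    refine ⟨⟨by linarith, by linarith⟩, ?_⟩
    change dist x (ν (Nat.pair a (Nat.pair M N)).unpair.1) < idealRadius (Nat.pair a (Nat.pair M N))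
    rw [hρ, Nat.unpair_pair]
    linarith

/-- In the ball, `d(x, z k) < ρ + 4ρ`, while `d_B(x) > 2ρ - ρ = ρ`. -/
lemma dist_le_of_mem_admissibleCover {r : Baire} {B : Closeds X} (hB : (B : Set X).Nonempty)
    (hr : distRep ν (right r) B) (h0 : ∀ i k, 1 ≤ component (left r) i k) {z : ℕ → X}
    (hz : ∀ i, cauchyRep ν (fun k => component (left r) i k - 1) (z i)) {j : ℕ} {x : X}
    (hx : x ∈ admissibleCover ν r j) : dist x (z j.unpair.2) ≤ 5 * Metric.infDist x B := by
  obtain ⟨h, h3⟩ := hx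
  obtain ⟨h1, h2⟩ := (admissible_iff hB hr h0 hz j).1 h
  have h4 : dist x (ν j.unpair.1.unpair.1) < idealRadius j.unpair.1 := h3
  have h5 : Metric.infDist (ν j.unpair.1.unpair.1) B ≤ Metric.infDist x B +
    dist (ν j.unpair.1.unpair.1) x := Metric.infDist_le_infDist_add_dist
  rw [dist_comm _ x] at h5
  have := dist_triangle x (ν j.unpair.1.unpair.1) (z j.unpair.2)
  linarith

lemma sigmaRep_admissibleCover {r t : Baire} {j : ℕ}
    (h : ∀ k, component t j k = 0 ∨ component t j k = j.unpair.1 + 1)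
    (h' : Admissible ν r j ↔ ∃ k, component t j k = j.unpair.1 + 1) :
    sigmaRep ν (component t j) (admissibleCover ν r j) := by
  simp only [sigmaRep, admissibleCover, Opens.coe_mk, h']
  ext x
  simp only [mem_ofPred_eq, mem_iUnion]
  constructor
  · rintro ⟨⟨k, hk⟩, hx⟩
    exact ⟨k, by omega, by simpa [hk] using hx⟩
  · rintro ⟨k, hk, hx⟩
    have hk' := (h k).resolve_left (by omega)
    exact ⟨⟨k, hk'⟩, by simpa [hk'] using hx⟩

end Cover

/-! ### Computing the digits of the values of the retraction -/

section Digits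

variable {X : Type*} [MetricSpace X] (ν : ℕ → X)

/-- The point with name `p` is recognized to lie in the ideal ball with code `w`. -/
def InBall (p : Baire) (w : ℕ) : Prop :=
  ∃ m y, p m = y ∧ dist (ν w.unpair.1) (ν y) * (((w.unpair.2.unpair.2 + 1) * 2 ^ m : ℕ) : ℝ) +
      ((w.unpair.2.unpair.2 + 1 : ℕ) : ℝ) < (((w.unpair.2.unpair.1 + 1) * 2 ^ m : ℕ) : ℝ)

/-- The number `v` is recognized to be admissible as `n`-th digit of a name of the value of the
retraction at the point with name `p`, because the point lies in an open set `W i`; here `s` is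
such that `η_e s` is a name of the sequence `W`, and `b` is a range name. -/
def DigitOutside (e s b p : Baire) (n v : ℕ) : Prop :=
  ∃ i k w, EtaDigit e s (Nat.pair i k) (w + 1) ∧ InBall ν p w ∧
    b (Nat.pair i.unpair.2 (n + 2)) = v + 1

/-- The number `v` is recognized to be admissible as `n`-th digit of a name of the value of the
retraction at the point with name `p`, because the point is close to the set with range
name `b`. -/
def DigitNear (b p : Baire) (n v : ℕ) : Prop :=
  ∃ m k y z, p m = y ∧ b (Nat.pair k m) = z + 1 ∧
    dist (ν y) (ν z) * ((2 ^ m * 2 ^ (n + 6) : ℕ) : ℝ) + ((2 * 2 ^ (n + 6) : ℕ) : ℝ) <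
      ((2 ^ m : ℕ) : ℝ) ∧ p (n + 3) = v

variable {ν} {γ : Type*} [Primcodable γ]

lemma semi_inBall (hX : IsComputableMetricSpace ν) {p : (ℕ → γ) → Baire}
    (hp : Semi fun o (x : ℕ × ℕ) => p o x.1 = x.2) : Semi fun o w => InBall ν (p o) w := by
  have hw : Computable fun x : (ℕ × ℕ) × ℕ => x.1.1 := Computable.fst.comp Computable.fst
  have hm : Computable fun x : (ℕ × ℕ) × ℕ => x.1.2 := Computable.snd.comp Computable.fst
  have hy : Computable fun x : (ℕ × ℕ) × ℕ => x.2 := Computable.snd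
  have hc := Computable.succ.comp (computable_unpair_snd (computable_unpair_snd hw))
  exact ((hp.comp (hm.pair hy)).and (Semi.dist_lt (γ := γ) hX (computable_unpair_fst hw) hy
    (computable_mul hc (computable_two_pow hm)) hc
    (computable_mul (Computable.succ.comp (computable_unpair_fst (computable_unpair_snd hw)))
      (computable_two_pow hm)))).exists.exists

lemma semi_digitOutside (hX : IsComputableMetricSpace ν) {e : Baire} (he : Computable e)
    {s b p : (ℕ → γ) → Baire} (hs : Semi fun o (x : ℕ × ℕ) => s o x.1 = x.2)
    (hb : Semi fun o (x : ℕ × ℕ) => b o x.1 = x.2)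
    (hp : Semi fun o (x : ℕ × ℕ) => p o x.1 = x.2) :
    Semi fun o (x : ℕ × ℕ) => DigitOutside ν e (s o) (b o) (p o) x.1 x.2 := by
  have hn : Computable fun x : (((ℕ × ℕ) × ℕ) × ℕ) × ℕ => x.1.1.1.1 :=
    Computable.fst.comp (Computable.fst.comp (Computable.fst.comp Computable.fst))
  have hv : Computable fun x : (((ℕ × ℕ) × ℕ) × ℕ) × ℕ => x.1.1.1.2 :=
    Computable.snd.comp (Computable.fst.comp (Computable.fst.comp Computable.fst))
  have hi : Computable fun x : (((ℕ × ℕ) × ℕ) × ℕ) × ℕ => x.1.1.2 :=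
    Computable.snd.comp (Computable.fst.comp Computable.fst)
  have hk : Computable fun x : (((ℕ × ℕ) × ℕ) × ℕ) × ℕ => x.1.2 :=
    Computable.snd.comp Computable.fst
  have hw : Computable fun x : (((ℕ × ℕ) × ℕ) × ℕ) × ℕ => x.2 := Computable.snd
  have h1 : Semi fun (o : ℕ → γ) (x : Unit × ℕ × ℕ) => EtaDigit e (s o) x.2.1 x.2.2 :=
    Semi.etaDigit (p := fun _ _ => e) (q := fun o _ => s o)
      (Semi.eq (he.comp (Computable.fst.comp Computable.snd)) (Computable.snd.comp Computable.snd))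
      (hs.comp Computable.snd)
  exact ((h1.comp ((Computable.const ()).pair ((Primrec₂.natPair.to_comp.comp hi hk).pair
    (Computable.succ.comp hw)))).and (((semi_inBall hX hp).comp hw).and
    (hb.comp ((Primrec₂.natPair.to_comp.comp (computable_unpair_snd hi)
      (computable_add hn (Computable.const 2))).pair
        (Computable.succ.comp hv))))).exists.exists.exists

lemma semi_digitNear (hX : IsComputableMetricSpace ν) {b p : (ℕ → γ) → Baire}
    (hb : Semi fun o (x : ℕ × ℕ) => b o x.1 = x.2)
    (hp : Semi fun o (x : ℕ × ℕ) => p o x.1 = x.2) :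
    Semi fun o (x : ℕ × ℕ) => DigitNear ν (b o) (p o) x.1 x.2 := by
  have hn : Computable fun x : ((((ℕ × ℕ) × ℕ) × ℕ) × ℕ) × ℕ => x.1.1.1.1.1 :=
    Computable.fst.comp (Computable.fst.comp (Computable.fst.comp (Computable.fst.comp
      Computable.fst)))
  have hv : Computable fun x : ((((ℕ × ℕ) × ℕ) × ℕ) × ℕ) × ℕ => x.1.1.1.1.2 :=
    Computable.snd.comp (Computable.fst.comp (Computable.fst.comp (Computable.fst.comp
      Computable.fst)))
  have hm : Computable fun x : ((((ℕ × ℕ) × ℕ) × ℕ) × ℕ) × ℕ => x.1.1.1.2 :=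
    Computable.snd.comp (Computable.fst.comp (Computable.fst.comp Computable.fst))
  have hk : Computable fun x : ((((ℕ × ℕ) × ℕ) × ℕ) × ℕ) × ℕ => x.1.1.2 :=
    Computable.snd.comp (Computable.fst.comp Computable.fst)
  have hy : Computable fun x : ((((ℕ × ℕ) × ℕ) × ℕ) × ℕ) × ℕ => x.1.2 :=
    Computable.snd.comp Computable.fst
  have hz : Computable fun x : ((((ℕ × ℕ) × ℕ) × ℕ) × ℕ) × ℕ => x.2 := Computable.snd
  have hn6 := computable_two_pow (computable_add hn (Computable.const 6))
  exact ((hp.comp (hm.pair hy)).and ((hb.comp ((Primrec₂.natPair.to_comp.comp hk hm).pair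
    (Computable.succ.comp hz))).and ((Semi.dist_lt (γ := γ) hX hy hz
      (computable_mul (computable_two_pow hm) hn6) (computable_mul (Computable.const 2) hn6)
      (computable_two_pow hm)).and (hp.comp ((computable_add hn (Computable.const 3)).pair
        hv))))).exists.exists.exists.exists

lemma inBall_iff {p : Baire} {x : X} (hp : cauchyRep ν p x) (w : ℕ) :
    InBall ν p w ↔ x ∈ idealBall ν w := by
  have : x ∈ idealBall ν w ↔ dist (ν w.unpair.1) x < idealRadius w := by
    rw [dist_comm]; rfl
  rw [this, dist_lt_iff_exists_approx hp, InBall]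
  refine exists_congr fun m => ?_
  rw [exists_eq_left', idealRadius_eq, ← one_mul (_ / _), ← add_lt_div_iff _ _ _ _ (by positivity)]
  push_cast
  rw [one_mul]

lemma digitOutside_iff {e s o b p : Baire} (ho : o ∈ eta e s) {W : ℕ → Opens X}
    (hW : seqRep (sigmaRep ν) o W) {x : X} (hp : cauchyRep ν p x) (n v : ℕ) :
    DigitOutside ν e s b p n v ↔ ∃ i, x ∈ W i ∧ component b i.unpair.2 (n + 2) = v + 1 := by
  simp only [DigitOutside, etaDigit_iff ho, inBall_iff hp, component]
  refine exists_congr fun i => ?_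
  have : x ∈ W i ↔ ∃ k w, o (Nat.pair i k) = w + 1 ∧ x ∈ idealBall ν w := by
    rw [← SetLike.mem_coe, hW i]
    simp only [mem_iUnion, component, mem_ofPred_eq]
    refine exists_congr fun k => ⟨fun ⟨h1, h2⟩ => ⟨_, by omega, h2⟩, fun ⟨w, h1, h2⟩ => ?_⟩
    exact ⟨by omega, by simpa [h1] using h2⟩
  rw [this]
  constructor
  · rintro ⟨k, w, h1, h2, h3⟩
    exact ⟨⟨k, w, h1, h2⟩, h3⟩
  · rintro ⟨⟨k, w, h1, h2⟩, h3⟩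
    exact ⟨k, w, h1, h2, h3⟩

/-- The term `2 * 2⁻¹ ^ m` pays for replacing both the point and the member of `B` by their `m`-th
approximations. -/
lemma digitNear_iff_exists {b p : Baire} (h0 : ∀ i k, 1 ≤ component b i k) (n v : ℕ) :
    DigitNear ν b p n v ↔ (∃ m k, dist (ν (p m)) (ν (component b k m - 1)) + 2 * (2 : ℝ)⁻¹ ^ m <
      (2 : ℝ)⁻¹ ^ (n + 6)) ∧ p (n + 3) = v := by
  have key : ∀ (d : ℝ) (m : ℕ), d * (2 ^ m * 2 ^ (n + 6)) + 2 * 2 ^ (n + 6) < 2 ^ m ↔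
      d + 2 * (2 : ℝ)⁻¹ ^ m < (2 : ℝ)⁻¹ ^ (n + 6) := by
    intro d m
    have h2 : (0 : ℝ) < (2 : ℝ) ^ m * 2 ^ (n + 6) := by positivity
    refine Iff.trans ?_ (mul_lt_mul_iff_left₀ h2)
    have e1 : (d + 2 * (2 : ℝ)⁻¹ ^ m) * (2 ^ m * 2 ^ (n + 6)) =
        d * (2 ^ m * 2 ^ (n + 6)) + 2 * 2 ^ (n + 6) := by
      rw [inv_pow]; field_simp
    have e2 : (2 : ℝ)⁻¹ ^ (n + 6) * (2 ^ m * 2 ^ (n + 6)) = 2 ^ m := by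
      rw [inv_pow]; field_simp
    rw [e1, e2]
  have hb : ∀ k m z, b (Nat.pair k m) = z + 1 ↔ component b k m - 1 = z := by
    intro k m z
    have := h0 k m
    simp only [component] at this ⊢
    omega
  simp only [DigitNear, hb, exists_and_left, exists_eq_left', ← key, ← exists_and_right]
  push_cast
  rfl

/-- The race always ends: off `B` some piece contains `x`, and on `B` the dense sequence comes
arbitrarily close to `x`. -/
lemma exists_digit {A B : Set X} {b p : Baire} {z : ℕ → X} {W : ℕ → Opens X} {x : X}
    (h0 : ∀ i k, 1 ≤ component b i k)
    (hz : ∀ i, cauchyRep ν (fun k => component b i k - 1) (z i)) (hd : B ⊆ closure (range z))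
    (hcov : (⋃ i, (W i : Set X)) ∩ A = A \ B) (hx : x ∈ A) (hp : cauchyRep ν p x) (n : ℕ) :
    ∃ v, (∃ i, x ∈ W i ∧ component b i.unpair.2 (n + 2) = v + 1) ∨ DigitNear ν b p n v := by
  by_cases hxB : x ∈ B
  · refine ⟨p (n + 3), Or.inr ((digitNear_iff_exists h0 n _).2 ⟨?_, rfl⟩)⟩
    obtain ⟨_, ⟨k, rfl⟩, hk⟩ := Metric.mem_closure_iff.1 (hd hxB) ((2 : ℝ)⁻¹ ^ (n + 7))
      (by positivity)
    -- In units of `2⁻¹ ^ (n + 10)`: distance 8, approximation errors 2 and the safety term 2 sum to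
    -- 12, below the threshold 16.
    refine ⟨n + 10, k, ?_⟩
    have h1 := hp.dist_le (n + 10)
    have h2 := (hz k).dist_le (n + 10)
    have h3 := dist_triangle4_right (ν (p (n + 10))) (ν (component b k (n + 10) - 1)) x (z k)
    have h4 : (0 : ℝ) < (2 : ℝ)⁻¹ ^ n := by positivity
    have e6 : (2 : ℝ)⁻¹ ^ (n + 6) = (2 : ℝ)⁻¹ ^ n / 64 := by rw [pow_add]; ring
    have e7 : (2 : ℝ)⁻¹ ^ (n + 7) = (2 : ℝ)⁻¹ ^ n / 128 := by rw [pow_add]; ring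
    have e10 : (2 : ℝ)⁻¹ ^ (n + 10) = (2 : ℝ)⁻¹ ^ n / 1024 := by rw [pow_add]; ring
    rw [e10] at h1 h2
    rw [e7] at hk
    rw [e6, e10]
    linarith
  · obtain ⟨i, hi⟩ := mem_iUnion.1 (hcov.symm.subset ⟨hx, hxB⟩).1
    have := h0 i.unpair.2 (n + 2)
    exact ⟨component b i.unpair.2 (n + 2) - 1, Or.inl ⟨i, hi, by omega⟩⟩

/-- In the near case `d_B(x) < 2⁻¹ ^ (n + 6)`, so `y` is within five such units of `x`. The digit `p
(n + 3)` adds eight more, and 13 is below the permitted 16. -/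
lemma dist_digit_le {B : Set X} {b p : Baire} {z : ℕ → X} {W : ℕ → Opens X} {x y : X}
    (h0 : ∀ i k, 1 ≤ component b i k)
    (hz : ∀ i, cauchyRep ν (fun k => component b i k - 1) (z i)) (hzB : ∀ i, z i ∈ B)
    (hy : ∀ i, x ∈ W i → y = z i.unpair.2) (hxy : dist x y ≤ 5 * Metric.infDist x B)
    (hp : cauchyRep ν p x) {n v : ℕ}
    (h : (∃ i, x ∈ W i ∧ component b i.unpair.2 (n + 2) = v + 1) ∨ DigitNear ν b p n v) :
    dist (ν v) y ≤ (2 : ℝ)⁻¹ ^ (n + 2) := by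
  rcases h with ⟨i, hi, hv⟩ | h
  · have := (hz i.unpair.2).dist_le (n + 2)
    rw [hy i hi]
    simpa [hv] using this
  · obtain ⟨⟨m, k, hmk⟩, rfl⟩ := (digitNear_iff_exists h0 n v).1 h
    have h1 := hp.dist_le (n + 3)
    have h2 := hp.dist_le m
    have h3 := (hz k).dist_le m
    have h4 := Metric.infDist_le_dist_of_mem (x := x) (hzB k)
    have h5 := dist_triangle4 x (ν (p m)) (ν (component b k m - 1)) (z k)
    have h6 := dist_triangle (ν (p (n + 3))) x y
    rw [dist_comm] at h2
    have h7 : (0 : ℝ) < (2 : ℝ)⁻¹ ^ n := by positivity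
    have e2 : (2 : ℝ)⁻¹ ^ (n + 2) = (2 : ℝ)⁻¹ ^ n / 4 := by rw [pow_add]; ring
    have e3 : (2 : ℝ)⁻¹ ^ (n + 3) = (2 : ℝ)⁻¹ ^ n / 8 := by rw [pow_add]; ring
    have e6 : (2 : ℝ)⁻¹ ^ (n + 6) = (2 : ℝ)⁻¹ ^ n / 64 := by rw [pow_add]; ring
    rw [e3] at h1
    rw [e6] at hmk
    rw [e2]
    linarith

/-- The output pairs an associate that runs the digit race with the translated name of the domain.
The associate is computed from `r` alone; the point name `p` enters only when it is evaluated. -/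
lemma exists_computable_output (hX : IsComputableMetricSpace ν) {eR eS : Baire}
    (heR : Computable eR) (heS : Computable eS) {u : Baire → Baire}
    (hu : Semi fun r (x : ℕ × ℕ) => u r x.1 = x.2) :
    ∃ e : Baire, Computable e ∧ ∀ r, ∀ q ∈ eta eR (left r), ∃ s ∈ eta e r, right s = q ∧
      ∀ p, (∀ n, ∃ v, DigitOutside ν eS (u r) (left (right r)) p n v ∨
          DigitNear ν (left (right r)) p n v) →
        ∃ s' ∈ eta (left s) p, ∀ n, DigitOutside ν eS (u r) (left (right r)) p n (s' n) ∨
          DigitNear ν (left (right r)) p n (s' n) := by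
  have hfst : Semi fun (o : ℕ → ℕ × ℕ) (x : ℕ × ℕ) => left (right fun i => (o i).1) x.1 = x.2 :=
    (Semi.id_graph.right_graph.left_graph).comap (φ := (Prod.fst : ℕ × ℕ → ℕ)) Primrec.fst
  have hsnd : Semi fun (o : ℕ → ℕ × ℕ) (x : ℕ × ℕ) => (o x.1).2 = x.2 :=
    Semi.id_graph.comap (φ := (Prod.snd : ℕ × ℕ → ℕ)) Primrec.snd
  have hu' : Semi fun (o : ℕ → ℕ × ℕ) (x : ℕ × ℕ) => u (fun i => (o i).1) x.1 = x.2 :=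
    hu.comap (φ := (Prod.fst : ℕ × ℕ → ℕ)) Primrec.fst
  have hD : Semi fun (o : ℕ → ℕ × ℕ) (x : ℕ × ℕ) =>
      DigitOutside ν eS (u fun i => (o i).1) (left (right fun i => (o i).1)) (fun i => (o i).2)
        x.1 x.2 ∨ DigitNear ν (left (right fun i => (o i).1)) (fun i => (o i).2) x.1 x.2 :=
    (semi_digitOutside hX heS (p := fun o i => (o i).2) hu' hfst hsnd).or
      (semi_digitNear hX (p := fun o i => (o i).2) hfst hsnd)
  obtain ⟨Q, hQ, hQd⟩ := hD.exists_associate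
  have hE : Semi fun (r : Baire) (x : Unit × ℕ × ℕ) => EtaDigit eR (left r) x.2.1 x.2.2 :=
    Semi.etaDigit (p := fun _ _ => eR) (q := fun r _ => left r)
      (Semi.eq (heR.comp (Computable.fst.comp Computable.snd))
        (Computable.snd.comp Computable.snd))
      (Semi.id_graph.left_graph.comp Computable.snd)
  obtain ⟨e, he, heD⟩ := (hQ.interleave (hE.comp (f := fun x : ℕ × ℕ => ((), x))
    ((Computable.const ()).pair Computable.id))).exists_realizer
  refine ⟨e, he, fun r q hq => ?_⟩
  obtain ⟨s, hs, hsd⟩ := heD r fun n => by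
    by_cases h : n % 2 = 0
    · exact ⟨Q r (n / 2), by simp [h]⟩
    · exact ⟨q (n / 2), by simpa [h] using (etaDigit_iff hq _ _).2 rfl⟩
  -- At even positions the relation is the graph of `Q r`, so the choice function has no freedom
  -- there.
  have hsl : left s = Q r := by
    funext n
    have := hsd (2 * n)
    simp only [Nat.mul_mod_right, if_true, Nat.mul_div_cancel_left n two_pos] at this
    exact this.symm
  refine ⟨s, hs, ?_, fun p hp => by rw [hsl]; exact hQd r p hp⟩
  funext n
  have := hsd (2 * n + 1)
  have h1 : (2 * n + 1) % 2 = 1 := by omega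
  have h2 : (2 * n + 1) / 2 = n := by omega
  simp only [h1, h2, one_ne_zero, if_false] at this
  exact ((etaDigit_iff hq _ _).1 this).symm

end Digits

end TTE

/-! ### Computability of the retraction operation -/

theorem mainTheorem1 {X : Type*} [MetricSpace X] (ν : ℕ → X)
    (hX : TTE.IsComputableMetricSpace ν)
    (𝒴 : Set (TopologicalSpace.Closeds X))
    (hdim : ∀ A ∈ 𝒴, HasSmallInductiveDimensionLE A 0)
    (δY : TTE.Naming (TopologicalSpace.Closeds X))
    (hδY : TTE.IsRepresentation δY 𝒴)
    (hred : TTE.Reduces δY (TTE.piRep ν))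
    (hS : TTE.DisjointifyComputable ν 𝒴 δY) :
    TTE.RetractComputable ν 𝒴 δY := by
  open TTE in
  obtain ⟨eR, heR, hR⟩ := hred
  obtain ⟨eS, heS, hS⟩ := hS
  obtain ⟨t, ht, htr⟩ := (semi_admissible hX).exists_listing
    (computable_unpair_fst (Computable.id (α := ℕ)))
  obtain ⟨e, he, heD⟩ := exists_computable_output hX heR heS
    (u := fun r => interleave (t r) (left r)) (ht.interleave_graph Semi.id_graph.left_graph)
  refine ⟨e, he, ?_⟩
  rintro ⟨A, B⟩ ⟨hA, hB, hBA, -⟩ r ⟨hrA, hrB, hrd⟩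
  simp only at hA hB hBA hrA hrB hrd
  obtain ⟨h, -⟩ | ⟨-, h0, z, hz, hzB, hd⟩ := hrB
  · exact absurd h hB.ne_empty
  obtain ⟨q, hq, hqA⟩ := hR _ _ hrA
  -- The input to `S̃` is built from `r` only, so `o` and `W` are fixed before any point is named.
  -- This makes `F` single-valued.
  obtain ⟨o, ho, W, ⟨hWV, hWA, hW⟩, hoW⟩ := hS (admissibleCover ν (right r), A) hA
    (interleave (t r) (left r)) ⟨by
      rw [left_interleave]
      exact fun j => sigmaRep_admissibleCover (htr r j).1 (htr r j).2, by
      rwa [right_interleave]⟩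
  have hcov : (⋃ i, (W i : Set X)) ∩ A = (A : Set X) \ B := by
    rw [hWA, iUnion_admissibleCover hX hB hrd h0 hz hd]
    exact Set.inter_comm _ _
  have hclose : ∀ j : ℕ, ∀ x ∈ W j, dist x (z j.unpair.2) ≤ 5 * Metric.infDist x B :=
    fun j x hx => dist_le_of_mem_admissibleCover hB hrd h0 hz (hWV j hx)
  have hzB' : ∀ j : ℕ, z j.unpair.2 ∈ (B : Set X) := fun j => hzB _
  obtain ⟨F, hFc, hFA, hFB, hFW, hFd⟩ := exists_retraction hzB' hW hcov hclose
  obtain ⟨s, hs, rfl, hsd⟩ := heD r q hq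
  have hF := retract_of_continuousOn hBA hFc hFA hFB
  refine ⟨s, hs, _, hF, hF.1, fun x hx p hp => ?_, A, hqA, rfl⟩
  have hD := digitOutside_iff ho hoW hp (b := left (right r))
  obtain ⟨s', hs', hsd'⟩ := hsd p fun n => by
    simp only [hD]
    exact exists_digit h0 hz hd hcov hx hp n
  simp only [hD] at hsd'
  exact ⟨s', hs', F x, (PFun.mem_res _ _ _ _).2 ⟨hx, rfl⟩, cauchyRep_of_dist_le fun n =>
    dist_digit_le h0 hz hzB (fun i hi => hFW x hx i hi) (hFd x hx) hp (hsd' n)⟩
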